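/- For a positive integer $m$ let $\sigma(m)$ denote the sum of the positive divisors of $m$, and put $\sigma(m)=0$ for every integer $m\le 0$. Let $n$ be a positive integer (so that both sums below have only finitely many nonzero terms). If $5\nmid n$, then $$\sum_{j=0}^\infty \sigma\big(2n+1-j(j+1)\big)\equiv 0 \pmod 5.$$ If $n$ is not a triangular number, that is, if there is no integer $k\ge 0$ with $n=k(k+1)/2$, then $$\sum_{j=0}^\infty \sigma\big(n-j(j+1)/2\big)\equiv 0 \pmod 4.$$ -/

import Mathlib

/-- The sum of the positive divisors of an integer `m` when `m` is positive, and `0` otherwise. -/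
def sumDiv (m : ℤ) : ℕ :=
  if 0 < m then ArithmeticFunction.sigma 1 m.toNat else 0

/-! Let ψ = Σ q^(j(j+1)/2), A = Σ a(k) q^k with a = `altSigma`, S = Σ σ(2m+1) q^m and θ = q d/dq.
Everything rests on θψ = Aψ and θS = 4AS. They reflect Gauss's product for ψ and Legendre's S = ψ⁴,
neither of which is used.

Mod 5: the Leibniz rule gives θ(ψS) = 5AψS, so 5 divides n times the n-th coefficient of ψS, and
that coefficient is the first sum. Mod 4: Aψ = θψ has coefficient 0 at a nontriangular n, and a ≡ σ
mod 4.

Compared coefficientwise, both differential equations are proved by Liouville's method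
(`sum_eq_sum_zeros`): a weight is summed over the solutions of a quadratic equation, two involutions
cancel everything off a diagonal, and the diagonal is summed explicitly. -/

/-- The divisor sum in which even divisors count negatively. -/
def altSigma (k : ℕ) : ℤ :=
  ∑ d ∈ k.divisors, if Even d then -(d : ℤ) else d

theorem altSigma_eq_sum_divisorsAntidiagonal (k : ℕ) :
    altSigma k = ∑ x ∈ k.divisorsAntidiagonal, if Even x.1 then -(x.1 : ℤ) else x.1 :=
  (Nat.sum_divisorsAntidiagonal fun d _ => if Even d then -(d : ℤ) else d).symm

/-! ### Liouville's cancellation principle -/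

/-- If `f + f ∘ σ` changes sign under an involution `φ` of the part of `s` where `r` is negative,
and `σ` exchanges the parts where `r` is negative and positive, then the sum of `f` over `s` is
carried by the zeros of `r`. -/
theorem sum_eq_sum_zeros {α : Type*} (s : Finset α) (f : α → ℤ) (r : α → ℤ)
    (σ φ : α → α) (hσ : ∀ z ∈ s, σ z ∈ s) (hσσ : ∀ z ∈ s, σ (σ z) = z)
    (hr : ∀ z ∈ s, r (σ z) = -r z)
    (hφ : ∀ z ∈ s, r z < 0 → φ z ∈ s) (hφr : ∀ z ∈ s, r z < 0 → r (φ z) < 0)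
    (hφφ : ∀ z ∈ s, r z < 0 → φ (φ z) = z)
    (hf : ∀ z ∈ s, r z < 0 → f (φ z) + f (σ (φ z)) = -(f z + f (σ z))) :
    ∑ z ∈ s, f z = ∑ z ∈ s with r z = 0, f z := by
  have h1 : ∑ z ∈ s with 0 < r z, f z = ∑ z ∈ s with r z < 0, f (σ z) := by
    refine Finset.sum_nbij' σ σ ?_ ?_ ?_ ?_ ?_ <;> simp only [Finset.mem_filter, and_imp]
    · intro z hz h
      exact ⟨hσ z hz, by rw [hr z hz]; linarith⟩
    · intro z hz h
      exact ⟨hσ z hz, by rw [hr z hz]; linarith⟩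
    · intro z hz _
      exact hσσ z hz
    · intro z hz _
      exact hσσ z hz
    · intro z hz _
      rw [hσσ z hz]
  have h2 : ∑ z ∈ s with r z < 0, (f z + f (σ z)) = 0 := by
    have h : ∑ z ∈ s with r z < 0, (f z + f (σ z))
        = ∑ z ∈ s with r z < 0, -(f z + f (σ z)) := by
      refine Finset.sum_nbij' φ φ ?_ ?_ ?_ ?_ ?_ <;> simp only [Finset.mem_filter, and_imp]
      · exact fun z hz h => ⟨hφ z hz h, hφr z hz h⟩
      · exact fun z hz h => ⟨hφ z hz h, hφr z hz h⟩
      · exact hφφ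
      · exact hφφ
      · intro z hz h
        rw [hf z hz h, neg_neg]
    rw [Finset.sum_neg_distrib] at h
    linarith
  rw [Finset.sum_add_distrib] at h2
  have h3 := Finset.sum_filter_add_sum_filter_not s (fun z => r z < 0) f
  have h4 := Finset.sum_filter_add_sum_filter_not {z ∈ s | ¬ r z < 0} (fun z => r z = 0) f
  rw [Finset.filter_filter, Finset.filter_filter] at h4
  have h5 : {z ∈ s | ¬ r z < 0 ∧ r z = 0} = {z ∈ s | r z = 0} :=
    Finset.filter_congr fun z _ => by omega
  have h6 : {z ∈ s | ¬ r z < 0 ∧ ¬ r z = 0} = {z ∈ s | 0 < r z} :=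
    Finset.filter_congr fun z _ => by omega
  rw [h5, h6] at h4
  linarith

/-! ### The equation θψ = Aψ, through triples -/

/-- The triples `(j, d, e)` of integers with `d, e > 0` and `j (j + 1) + d e = 2 n`. -/
noncomputable def pronicTriples (n : ℕ) : Finset (ℤ × ℤ × ℤ) :=
  {z ∈ Finset.Icc (-(2 * n + 1 : ℤ)) (2 * n + 1) ×ˢ Finset.Icc (1 : ℤ) (2 * n) ×ˢ
    Finset.Icc (1 : ℤ) (2 * n) | z.1 * (z.1 + 1) + z.2.1 * z.2.2 = 2 * n}

theorem mem_pronicTriples {n : ℕ} {j d e : ℤ} :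
    (j, d, e) ∈ pronicTriples n ↔ 0 < d ∧ 0 < e ∧ j * (j + 1) + d * e = 2 * n := by
  simp only [pronicTriples, Finset.mem_filter, Finset.mem_product, Finset.mem_Icc]
  constructor
  · rintro ⟨⟨-, ⟨h1, -⟩, h2, -⟩, h⟩
    exact ⟨by omega, by omega, h⟩
  · rintro ⟨hd, he, h⟩
    have h0 : 0 ≤ j * (j + 1) := by
      rcases le_or_gt 0 j with hj | hj
      · positivity
      · nlinarith
    refine ⟨⟨⟨?_, ?_⟩, ⟨hd, ?_⟩, ⟨he, ?_⟩⟩, h⟩ <;> nlinarith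

/-- The function on triples to which the involution is applied. -/
def tripleWeight (z : ℤ × ℤ × ℤ) : ℤ :=
  if Even z.2.2 then (if Even z.2.1 then z.2.1 else -z.2.1) else 2 * z.1 + 1

theorem even_or_even_of_mem_pronicTriples {n : ℕ} {j d e : ℤ} (h : (j, d, e) ∈ pronicTriples n) :
    Even d ∨ Even e := by
  have h1 := (mem_pronicTriples.1 h).2.2
  have h2 := Int.even_mul_succ_self j
  have h3 : Even (d * e) := by
    have : d * e = 2 * n - j * (j + 1) := by linarith
    rw [this]
    exact (even_two_mul _).sub h2
  exact Int.even_mul.1 h3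

/-- The map φ fixes d and replaces e by e - 2j - 1 - d. For even d this flips the parity of e; for
odd d, e is even and stays even. The weight is chosen so that its σ-symmetrization changes sign in
each case. -/
theorem sum_tripleWeight_eq_sum_diag (n : ℕ) :
    ∑ z ∈ pronicTriples n, tripleWeight z =
      ∑ z ∈ pronicTriples n with 2 * z.1 + 1 - (z.2.2 - z.2.1) = 0, tripleWeight z := by
  refine sum_eq_sum_zeros _ _ _ (fun z => (-1 - z.1, z.2.2, z.2.1))
    (fun z => (-z.1 - 1 - z.2.1, z.2.1, z.2.2 - 2 * z.1 - 1 - z.2.1)) ?_ ?_ ?_ ?_ ?_ ?_ ?_ <;>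
    rintro ⟨j, d, e⟩ hz <;> have hm := mem_pronicTriples.1 hz <;> dsimp only
  · rw [mem_pronicTriples]
    exact ⟨hm.2.1, hm.1, by linarith⟩
  · ext <;> simp
  · ring
  · intro hr
    rw [mem_pronicTriples]
    exact ⟨hm.1, by linarith, by linarith⟩
  · intro hr
    linarith
  · intro hr
    ext <;> simp <;> ring
  · intro hr
    have hp := even_or_even_of_mem_pronicTriples hz
    rcases Int.even_or_odd d with hd | hd <;> rcases Int.even_or_odd e with he | he
    · have h2 : ¬ Even (e - 2 * j - 1 - d) := by grind
      simp only [tripleWeight, hd, he, h2, if_true, if_false]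
      ring
    · have h2 : Even (e - 2 * j - 1 - d) := by grind
      have he' := Int.not_even_iff_odd.2 he
      simp only [tripleWeight, hd, he', h2, if_true, if_false]
      ring
    · have h2 : Even (e - 2 * j - 1 - d) := by grind
      have hd' := Int.not_even_iff_odd.2 hd
      simp only [tripleWeight, hd', he, h2, if_true, if_false]
      ring
    · grind

/-- The reflection j ↦ -1 - j negates the weight for odd e and preserves it for even e = 2x, where d
x = n - j(j+1)/2; hence the factor 2. Indices where the subtraction truncates contribute `altSigma 0
= 0`. -/
theorem sum_tripleWeight_eq (n : ℕ) :
    ∑ z ∈ pronicTriples n, tripleWeight z =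
      -2 * ∑ j ∈ Finset.range (n + 1), altSigma (n - j * (j + 1) / 2) := by
  have h1 := Finset.sum_filter_add_sum_filter_not (pronicTriples n) (fun z => Even z.2.2)
    tripleWeight
  have h2 : ∑ z ∈ pronicTriples n with ¬ Even z.2.2, tripleWeight z = 0 := by
    have h : ∑ z ∈ pronicTriples n with ¬ Even z.2.2, tripleWeight z =
        ∑ z ∈ pronicTriples n with ¬ Even z.2.2, -tripleWeight z := by
      refine Finset.sum_nbij' (fun z => (-1 - z.1, z.2)) (fun z => (-1 - z.1, z.2))
        ?_ ?_ ?_ ?_ ?_ <;> rintro ⟨j, d, e⟩ hz <;>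
        simp only [Finset.mem_filter, mem_pronicTriples] at hz ⊢
      · exact ⟨⟨hz.1.1, hz.1.2.1, by linarith⟩, hz.2⟩
      · exact ⟨⟨hz.1.1, hz.1.2.1, by linarith⟩, hz.2⟩
      · simp
      · simp
      · simp only [tripleWeight, hz.2, if_false]
        ring
    rw [Finset.sum_neg_distrib] at h
    linarith
  have h3 := Finset.sum_filter_add_sum_filter_not {z ∈ pronicTriples n | Even z.2.2}
    (fun z => 0 ≤ z.1) tripleWeight
  rw [Finset.filter_filter, Finset.filter_filter] at h3
  have h4 : ∑ z ∈ pronicTriples n with Even z.2.2 ∧ ¬ 0 ≤ z.1, tripleWeight z =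
      ∑ z ∈ pronicTriples n with Even z.2.2 ∧ 0 ≤ z.1, tripleWeight z := by
    refine Finset.sum_nbij' (fun z => (-1 - z.1, z.2)) (fun z => (-1 - z.1, z.2))
      ?_ ?_ ?_ ?_ ?_ <;> rintro ⟨j, d, e⟩ hz <;>
      simp only [Finset.mem_filter, mem_pronicTriples] at hz ⊢
    · exact ⟨⟨hz.1.1, hz.1.2.1, by linarith⟩, hz.2.1, by omega⟩
    · exact ⟨⟨hz.1.1, hz.1.2.1, by linarith⟩, hz.2.1, by omega⟩
    · simp
    · simp
    · simp only [tripleWeight, hz.2.1, if_true]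
  have h5 : ∑ j ∈ Finset.range (n + 1), altSigma (n - j * (j + 1) / 2) =
      ∑ z ∈ pronicTriples n with Even z.2.2 ∧ 0 ≤ z.1, -tripleWeight z := by
    simp only [altSigma_eq_sum_divisorsAntidiagonal]
    rw [Finset.sum_sigma']
    refine Finset.sum_nbij' (fun y => ((y.1 : ℤ), (y.2.1 : ℤ), 2 * (y.2.2 : ℤ)))
      (fun z => ⟨z.1.toNat, z.2.1.toNat, (z.2.2 / 2).toNat⟩) ?_ ?_ ?_ ?_ ?_
    · rintro ⟨j, d, x⟩ hy
      simp only [Finset.mem_sigma, Finset.mem_range, Nat.mem_divisorsAntidiagonal] at hy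
      obtain ⟨t, ht⟩ := (Nat.even_mul_succ_self j).two_dvd
      rw [ht, Nat.mul_div_cancel_left _ two_pos] at hy
      have hd : 0 < d := by
        rcases Nat.eq_zero_or_pos d with rfl | h
        · omega
        · exact h
      have hx : 0 < x := by
        rcases Nat.eq_zero_or_pos x with rfl | h
        · omega
        · exact h
      have hs : t + d * x = n := by omega
      have ht' : (j : ℤ) * (j + 1) = 2 * t := by exact_mod_cast ht
      have hs' : (t : ℤ) + d * x = n := by exact_mod_cast hs
      simp only [Finset.mem_filter, mem_pronicTriples]
      exact ⟨⟨by omega, by omega, by linarith⟩, even_two_mul _, by omega⟩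
    · rintro ⟨j, d, e⟩ hz
      simp only [Finset.mem_filter, mem_pronicTriples] at hz
      obtain ⟨⟨hd, he, h⟩, ⟨x, hx⟩, hj⟩ := hz
      lift j to ℕ using hj
      lift d to ℕ using hd.le
      lift x to ℕ using by omega
      obtain ⟨t, ht⟩ := (Nat.even_mul_succ_self j).two_dvd
      have hs : 2 * t + d * (x + x) = 2 * n := by
        rw [← ht]
        subst hx
        exact_mod_cast h
      have hs' : t + d * x = n := by linarith
      have hdx : 0 < d * x := Nat.mul_pos (by omega) (by omega)
      have hx2 : (e / 2).toNat = x := by omega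
      simp only [Finset.mem_sigma, Finset.mem_range, Nat.mem_divisorsAntidiagonal,
        Int.toNat_natCast, hx2]
      rw [ht, Nat.mul_div_cancel_left _ two_pos]
      refine ⟨?_, by omega, by omega⟩
      have : j ≤ t := by nlinarith
      omega
    · rintro ⟨j, d, x⟩ -
      simp
    · rintro ⟨j, d, e⟩ hz
      simp only [Finset.mem_filter, mem_pronicTriples] at hz
      obtain ⟨⟨hd, he, h⟩, ⟨x, hx⟩, hj⟩ := hz
      ext <;> simp <;> omega
    · rintro ⟨j, d, x⟩ -
      simp only [tripleWeight, even_two_mul, if_true, Int.even_coe_nat]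
      split_ifs <;> simp
  rw [Finset.sum_neg_distrib] at h5
  linarith

theorem sum_altSigma_of_not_triangular {n : ℕ} (hn : ¬ ∃ k : ℕ, n = k * (k + 1) / 2) :
    ∑ j ∈ Finset.range (n + 1), altSigma (n - j * (j + 1) / 2) = 0 := by
  have h := sum_tripleWeight_eq n
  rw [sum_tripleWeight_eq_sum_diag, Finset.sum_eq_zero] at h
  · linarith
  · rintro ⟨j, d, e⟩ hz
    simp only [Finset.mem_filter, mem_pronicTriples] at hz
    obtain ⟨⟨hd, he, h⟩, hr⟩ := hz
    refine absurd ⟨(j + d).toNat, ?_⟩ hn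
    -- On the diagonal d + e = 2(j + d) + 1, so j + d ≥ 0.
    have hk : ((j + d).toNat : ℤ) = j + d := Int.toNat_of_nonneg (by omega)
    have h2 : (j + d).toNat * ((j + d).toNat + 1) = 2 * n := by
      zify
      rw [hk, ← h]
      have he' : e = d + 2 * j + 1 := by linarith
      subst he'
      ring
    omega

/-- The bound s is freed from r to allow induction; at s = r the value is -r(r + 1). -/
theorem sum_diag_weight (r s : ℕ) :
    ∑ d ∈ Finset.Icc 1 (2 * s), (if Even d then 2 * ((r : ℤ) - d) + 1 else -(d : ℤ)) =
      2 * r * s - 3 * s * (s - 1) - 4 * s := by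
  induction s with
  | zero => simp
  | succ s ih =>
    rw [show 2 * (s + 1) = 2 * s + 1 + 1 by ring, Finset.sum_Icc_succ_top (by omega),
      Finset.sum_Icc_succ_top (by omega), ih, if_neg (by grind), if_pos (by grind)]
    push_cast
    ring

theorem sum_altSigma_triangular (r : ℕ) :
    ∑ j ∈ Finset.range (r * (r + 1) / 2 + 1), altSigma (r * (r + 1) / 2 - j * (j + 1) / 2) =
      (r * (r + 1) / 2 : ℕ) := by
  obtain ⟨n, hn⟩ := (Nat.even_mul_succ_self r).two_dvd
  rw [hn, Nat.mul_div_cancel_left _ two_pos]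
  have hn' : (r : ℤ) * (r + 1) = 2 * n := by exact_mod_cast hn
  have h := sum_tripleWeight_eq n
  have h1 : ∑ z ∈ pronicTriples n with 2 * z.1 + 1 - (z.2.2 - z.2.1) = 0, tripleWeight z =
      ∑ d ∈ Finset.Icc 1 (2 * r), (if Even d then 2 * ((r : ℤ) - d) + 1 else -(d : ℤ)) := by
    have key : ∀ z ∈ {z ∈ pronicTriples n | 2 * z.1 + 1 - (z.2.2 - z.2.1) = 0},
        0 < z.2.1 ∧ z.1 = r - z.2.1 ∧ z.2.2 = 2 * r + 1 - z.2.1 ∧ z.2.1 < 2 * r + 1 := by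
      rintro ⟨j, d, e⟩ hz
      simp only [Finset.mem_filter, mem_pronicTriples] at hz
      obtain ⟨⟨hd, he, h⟩, hr⟩ := hz
      have he' : e = d + 2 * j + 1 := by linarith
      have hsq : (j + d) * (j + d + 1) = r * (r + 1) := by
        rw [hn', ← h, he']
        ring
      have hjd : j + d = r := by
        have h0 : (j + d - r) * (j + d + r + 1) = 0 := by linarith
        -- The second factor is positive, since 2(j + d) + 1 = d + e > 0.
        rcases mul_eq_zero.1 h0 with h0 | h0 <;> omega
      dsimp only
      omega
    refine Finset.sum_nbij' (fun z => z.2.1.toNat)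
      (fun d => ((r : ℤ) - d, (d : ℤ), 2 * (r : ℤ) + 1 - d)) ?_ ?_ ?_ ?_ ?_
    · intro z hz
      have := key z hz
      rw [Finset.mem_Icc]
      omega
    · intro d hd
      rw [Finset.mem_Icc] at hd
      simp only [Finset.mem_filter, mem_pronicTriples]
      exact ⟨⟨by omega, by omega, by rw [← hn']; ring⟩, by ring⟩
    · intro z hz
      have := key z hz
      ext <;> dsimp only <;> omega
    · intro d hd
      simp
    · intro z hz
      obtain ⟨hd, hj, he, hlt⟩ := key z hz
      obtain ⟨d, hd'⟩ := Int.eq_ofNat_of_zero_le hd.le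
      rw [tripleWeight, hj, he, hd', Int.toNat_natCast]
      by_cases hde : Even d
      · rw [if_neg (by grind), if_pos hde]
      · rw [if_pos (by grind), if_neg (by grind), if_neg hde]
  rw [sum_tripleWeight_eq_sum_diag, h1, sum_diag_weight] at h
  nlinarith

/-! ### The equation θS = 4AS, through quadruples -/

/-- The quadruples `(a, b, x, y)` of positive integers with `a x + b y = N`. -/
noncomputable def productQuadruples (N : ℕ) : Finset (ℤ × ℤ × ℤ × ℤ) :=
  {z ∈ Finset.Icc (1 : ℤ) N ×ˢ Finset.Icc (1 : ℤ) N ×ˢ Finset.Icc (1 : ℤ) N ×ˢ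
    Finset.Icc (1 : ℤ) N | z.1 * z.2.2.1 + z.2.1 * z.2.2.2 = N}

theorem mem_productQuadruples {N : ℕ} {a b x y : ℤ} :
    (a, b, x, y) ∈ productQuadruples N ↔
      0 < a ∧ 0 < b ∧ 0 < x ∧ 0 < y ∧ a * x + b * y = N := by
  simp only [productQuadruples, Finset.mem_filter, Finset.mem_product, Finset.mem_Icc]
  constructor
  · rintro ⟨⟨⟨h1, -⟩, ⟨h2, -⟩, ⟨h3, -⟩, h4, -⟩, h⟩
    exact ⟨by omega, by omega, by omega, by omega, h⟩
  · rintro ⟨ha, hb, hx, hy, h⟩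
    have h1 : 0 < a * x := mul_pos ha hx
    have h2 : 0 < b * y := mul_pos hb hy
    refine ⟨⟨⟨ha, ?_⟩, ⟨hb, ?_⟩, ⟨hx, ?_⟩, ⟨hy, ?_⟩⟩, h⟩ <;> nlinarith

/-- The function on quadruples to which the involution is applied. -/
def quadWeight (z : ℤ × ℤ × ℤ × ℤ) : ℤ :=
  let (a, b, x, y) := z
  if Even b ∨ Even y then 0
  else if Even x then (if Even a then -(a * y + x * b) else a * x + a * y - b * y)
  else b * x + b * y - a * x

/-- The summand whose sum is the convolution of `altSigma` with the divisor sum. -/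
def convWeight (z : ℤ × ℤ × ℤ × ℤ) : ℤ :=
  let (a, b, x, y) := z
  if Odd b ∧ Odd y ∧ Even x then (if Even a then -a else a) * y else 0

theorem sum_quadWeight_eq_sum_diag (m : ℕ) :
    ∑ z ∈ productQuadruples (2 * m + 1), quadWeight z =
      ∑ z ∈ productQuadruples (2 * m + 1) with z.2.1 - z.1 = 0, quadWeight z := by
  refine sum_eq_sum_zeros _ _ _ (fun z => (z.2.1, z.1, z.2.2.2, z.2.2.1))
    (fun z => (z.2.2.1 + z.2.2.2, z.2.2.1, z.2.1, z.1 - z.2.1)) ?_ ?_ ?_ ?_ ?_ ?_ ?_ <;>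
    rintro ⟨a, b, x, y⟩ hz <;> have hm := mem_productQuadruples.1 hz <;> dsimp only
  · rw [mem_productQuadruples]
    exact ⟨hm.2.1, hm.1, hm.2.2.2.1, hm.2.2.1, by linarith⟩
  · ring
  · intro hr
    rw [mem_productQuadruples]
    exact ⟨by linarith, by linarith, by linarith, by linarith, by linarith⟩
  · intro hr
    linarith
  · intro hr
    ext <;> simp
  · intro hr
    have hodd : Odd (a * x + b * y) := by
      rw [hm.2.2.2.2]
      push_cast
      exact odd_two_mul_add_one _
    rcases Int.even_or_odd a with ha | ha <;> rcases Int.even_or_odd b with hb | hb <;>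
      rcases Int.even_or_odd x with hx | hx <;> rcases Int.even_or_odd y with hy | hy <;>
      simp only [← Int.not_even_iff_odd] at ha hb hx hy hodd <;>
      simp [quadWeight, Int.even_add, Int.even_sub, Int.even_mul, ha, hb, hx, hy] at hodd ⊢ <;>
      ring

/-- The two weights do not match termwise. They do after symmetrization under the duality (a, b, x,
y) ↦ (x, y, a, b), which preserves the set of quadruples. -/
theorem sum_quadWeight_eq_sum_convWeight (m : ℕ) :
    ∑ z ∈ productQuadruples (2 * m + 1), quadWeight z =
      2 * ∑ z ∈ productQuadruples (2 * m + 1), convWeight z := by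
  have hswap : ∀ f : ℤ × ℤ × ℤ × ℤ → ℤ, ∑ z ∈ productQuadruples (2 * m + 1), f z =
      ∑ z ∈ productQuadruples (2 * m + 1), f (z.2.2.1, z.2.2.2, z.1, z.2.1) := by
    intro f
    refine Finset.sum_nbij' (fun z => (z.2.2.1, z.2.2.2, z.1, z.2.1))
      (fun z => (z.2.2.1, z.2.2.2, z.1, z.2.1)) ?_ ?_ ?_ ?_ ?_ <;> rintro ⟨a, b, x, y⟩ hz <;>
      simp only [mem_productQuadruples] at hz ⊢
    · exact ⟨hz.2.2.1, hz.2.2.2.1, hz.1, hz.2.1, by linarith⟩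
    · exact ⟨hz.2.2.1, hz.2.2.2.1, hz.1, hz.2.1, by linarith⟩
  have h : ∑ z ∈ productQuadruples (2 * m + 1),
        (quadWeight z + quadWeight (z.2.2.1, z.2.2.2, z.1, z.2.1)) =
      ∑ z ∈ productQuadruples (2 * m + 1),
        2 * (convWeight z + convWeight (z.2.2.1, z.2.2.2, z.1, z.2.1)) := by
    refine Finset.sum_congr rfl ?_
    rintro ⟨a, b, x, y⟩ hz
    have hm := mem_productQuadruples.1 hz
    have hodd : Odd (a * x + b * y) := by
      rw [hm.2.2.2.2]
      push_cast
      exact odd_two_mul_add_one _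
    rcases Int.even_or_odd a with ha | ha <;> rcases Int.even_or_odd b with hb | hb <;>
      rcases Int.even_or_odd x with hx | hx <;> rcases Int.even_or_odd y with hy | hy <;>
      simp only [← Int.not_even_iff_odd] at ha hb hx hy hodd <;>
      simp [quadWeight, convWeight, Int.even_add, Int.even_mul, ← Int.not_even_iff_odd,
        ha, hb, hx, hy] at hodd ⊢ <;>
      ring
  rw [← Finset.mul_sum, Finset.sum_add_distrib, Finset.sum_add_distrib, ← hswap, ← hswap] at h
  linarith

theorem sum_convWeight_eq (m : ℕ) :
    ∑ z ∈ productQuadruples (2 * m + 1), convWeight z =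
      ∑ u ∈ Finset.HasAntidiagonal.antidiagonal m,
        altSigma u.1 * (ArithmeticFunction.sigma 1 (2 * u.2 + 1) : ℤ) := by
  have h1 : ∀ u : ℕ × ℕ, altSigma u.1 * (ArithmeticFunction.sigma 1 (2 * u.2 + 1) : ℤ) =
      ∑ w ∈ u.1.divisorsAntidiagonal ×ˢ (2 * u.2 + 1).divisorsAntidiagonal,
        (if Even w.1.1 then -(w.1.1 : ℤ) else w.1.1) * w.2.2 := by
    intro u
    rw [altSigma_eq_sum_divisorsAntidiagonal, ArithmeticFunction.sigma_one_apply,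
      ← Nat.sum_divisorsAntidiagonal' fun _ d => d, Nat.cast_sum, Finset.sum_mul_sum,
      Finset.sum_product]
  simp only [h1]
  rw [Finset.sum_sigma', ← Finset.sum_filter_add_sum_filter_not (productQuadruples (2 * m + 1))
    (fun z => Odd z.2.1 ∧ Odd z.2.2.2 ∧ Even z.2.2.1) convWeight,
    Finset.sum_eq_zero (s := {z ∈ productQuadruples (2 * m + 1) | ¬ _}), add_zero]
  · symm
    refine Finset.sum_nbij'
      (fun w => ((w.2.1.1 : ℤ), (w.2.2.1 : ℤ), 2 * (w.2.1.2 : ℤ), (w.2.2.2 : ℤ)))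
      (fun z => ⟨(z.1.toNat * (z.2.2.1 / 2).toNat, (z.2.1.toNat * z.2.2.2.toNat) / 2),
        (z.1.toNat, (z.2.2.1 / 2).toNat), (z.2.1.toNat, z.2.2.2.toNat)⟩) ?_ ?_ ?_ ?_ ?_
    · rintro ⟨⟨u, v⟩, ⟨a, x⟩, ⟨b, y⟩⟩ hw
      simp only [Finset.mem_sigma, Finset.HasAntidiagonal.mem_antidiagonal, Finset.mem_product,
        Nat.mem_divisorsAntidiagonal] at hw
      obtain ⟨huv, ⟨hax, hu⟩, hby, -⟩ := hw
      have hb : Odd (b * y) := hby ▸ odd_two_mul_add_one v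
      have ha0 : a ≠ 0 := by rintro rfl; simp at hax; omega
      have hx0 : x ≠ 0 := by rintro rfl; simp at hax; omega
      obtain ⟨hb, hy⟩ := Nat.odd_mul.1 hb
      have h : a * (2 * x) + b * y = 2 * m + 1 := by
        rw [hby, ← huv, ← hax]
        ring
      simp only [Finset.mem_filter, mem_productQuadruples, Int.odd_coe_nat]
      exact ⟨⟨by omega, by exact_mod_cast hb.pos, by omega, by exact_mod_cast hy.pos,
        by exact_mod_cast h⟩, hb, hy, even_two_mul _⟩
    · rintro ⟨a, b, x, y⟩ hz
      simp only [Finset.mem_filter, mem_productQuadruples] at hz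
      obtain ⟨⟨ha, hb, hx, hy, h⟩, hob, hoy, x, rfl⟩ := hz
      lift a to ℕ using ha.le
      lift b to ℕ using hb.le
      lift x to ℕ using by omega
      lift y to ℕ using hy.le
      obtain ⟨v, hv⟩ := Nat.odd_mul.2 ⟨(Int.odd_coe_nat b).1 hob, (Int.odd_coe_nat y).1 hoy⟩
      have hx2 : (((x : ℤ) + x) / 2).toNat = x := by omega
      have h' : a * (x + x) + b * y = 2 * m + 1 := by exact_mod_cast h
      have hax : 0 < a * x := Nat.mul_pos (by omega) (by omega)
      simp only [Finset.mem_sigma, Finset.HasAntidiagonal.mem_antidiagonal, Finset.mem_product,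
        Nat.mem_divisorsAntidiagonal, Int.toNat_natCast, hx2, hv]
      rw [mul_add] at h'
      exact ⟨by omega, ⟨by trivial, by omega⟩, by omega, by omega⟩
    · rintro ⟨⟨u, v⟩, ⟨a, x⟩, ⟨b, y⟩⟩ hw
      simp only [Finset.mem_sigma, Finset.HasAntidiagonal.mem_antidiagonal, Finset.mem_product,
        Nat.mem_divisorsAntidiagonal] at hw
      obtain ⟨huv, ⟨hax, hu⟩, hby, -⟩ := hw
      have hx2 : (2 * (x : ℤ) / 2).toNat = x := by omega
      have hv : (2 * v + 1) / 2 = v := by omega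
      simp only [Int.toNat_natCast, hx2, hax, hby, hv]
    · rintro ⟨a, b, x, y⟩ hz
      simp only [Finset.mem_filter, mem_productQuadruples] at hz
      obtain ⟨⟨ha, hb, hx, hy, h⟩, hob, hoy, x, rfl⟩ := hz
      ext <;> dsimp only <;> omega
    · rintro ⟨⟨u, v⟩, ⟨a, x⟩, ⟨b, y⟩⟩ hw
      simp only [Finset.mem_sigma, Finset.HasAntidiagonal.mem_antidiagonal, Finset.mem_product,
        Nat.mem_divisorsAntidiagonal] at hw
      have hb : Odd (b * y) := hw.2.2.1 ▸ odd_two_mul_add_one v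
      obtain ⟨hb, hy⟩ := Nat.odd_mul.1 hb
      simp only [convWeight, Int.odd_coe_nat, hb, hy, even_two_mul, Int.even_coe_nat, and_self,
        if_true]
  · rintro ⟨a, b, x, y⟩ hz
    exact if_neg (Finset.mem_filter.1 hz).2

/-- For a = b the equation is a c = 2m + 1 with c = x + y odd. Odd x forces y even and weight 0; x =
2t gives weight 2at with 1 ≤ t ≤ (c - 1)/2. Four times the sum over t is a c² - a = (2m + 1)c - a,
and both c and a run over the divisors of 2m + 1. -/
theorem four_mul_sum_diag_quadWeight (m : ℕ) :
    4 * ∑ z ∈ productQuadruples (2 * m + 1) with z.2.1 - z.1 = 0, quadWeight z =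
      2 * m * (ArithmeticFunction.sigma 1 (2 * m + 1) : ℤ) := by
  have h1 : ∑ z ∈ productQuadruples (2 * m + 1) with z.2.1 - z.1 = 0, quadWeight z =
      ∑ w ∈ (2 * m + 1).divisorsAntidiagonal, ∑ t ∈ Finset.Icc 1 (w.2 / 2),
        2 * (w.1 : ℤ) * t := by
    rw [← Finset.sum_filter_add_sum_filter_not {z ∈ productQuadruples (2 * m + 1) | _}
      (fun z => Even z.2.2.1) quadWeight,
      Finset.sum_eq_zero (s := {z ∈ {z ∈ productQuadruples (2 * m + 1) | _} | ¬ _}), add_zero,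
      Finset.sum_sigma']
    · have key : ∀ z ∈ {z ∈ {z ∈ productQuadruples (2 * m + 1) | z.2.1 - z.1 = 0} |
          Even z.2.2.1}, ∃ a t y : ℕ, z = ((a : ℤ), (a : ℤ), 2 * (t : ℤ), (y : ℤ)) ∧
            0 < a ∧ 0 < t ∧ Odd a ∧ Odd y ∧ a * (2 * t + y) = 2 * m + 1 := by
        rintro ⟨a, b, x, y⟩ hz
        simp only [Finset.mem_filter, mem_productQuadruples] at hz
        obtain ⟨⟨⟨ha, hb, hx, hy, h⟩, hr⟩, x, rfl⟩ := hz
        obtain rfl : b = a := by omega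
        lift b to ℕ using hb.le
        lift x to ℕ using by omega
        lift y to ℕ using hy.le
        have h' : b * (2 * x + y) = 2 * m + 1 := by
          zify
          push_cast at h
          linarith
        have ho : Odd (b * (2 * x + y)) := h' ▸ odd_two_mul_add_one m
        obtain ⟨ho1, ho2⟩ := Nat.odd_mul.1 ho
        refine ⟨b, x, y, by rw [two_mul], by omega, by omega, ho1, ?_, h'⟩
        grind
      refine Finset.sum_nbij'
        (fun z => ⟨(z.1.toNat, z.2.2.1.toNat + z.2.2.2.toNat), (z.2.2.1 / 2).toNat⟩)
        (fun w => ((w.1.1 : ℤ), (w.1.1 : ℤ), 2 * (w.2 : ℤ), (w.1.2 : ℤ) - 2 * (w.2 : ℤ)))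
        ?_ ?_ ?_ ?_ ?_
      · intro z hz
        obtain ⟨a, t, y, rfl, ha, ht, hoa, hoy, h⟩ := key z hz
        have h2 : (2 * (t : ℤ)).toNat = 2 * t := by omega
        have h3 : (2 * (t : ℤ) / 2).toNat = t := by omega
        simp only [Finset.mem_sigma, Nat.mem_divisorsAntidiagonal, Finset.mem_Icc,
          Int.toNat_natCast, h2, h3]
        exact ⟨⟨h, by omega⟩, by omega, by omega⟩
      · rintro ⟨⟨a, c⟩, t⟩ hw
        simp only [Finset.mem_sigma, Nat.mem_divisorsAntidiagonal, Finset.mem_Icc] at hw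
        obtain ⟨⟨h, -⟩, ht, ht'⟩ := hw
        have ho : Odd (a * c) := h ▸ odd_two_mul_add_one m
        obtain ⟨ho1, ho2⟩ := Nat.odd_mul.1 ho
        have h' : (a : ℤ) * c = 2 * m + 1 := by exact_mod_cast h
        have := ho1.pos
        obtain ⟨k, hk⟩ := ho2
        simp only [Finset.mem_filter, mem_productQuadruples]
        refine ⟨⟨⟨by omega, by omega, by omega, by omega, ?_⟩, by ring⟩, even_two_mul _⟩
        push_cast
        linarith
      · intro z hz
        obtain ⟨a, t, y, rfl, ha, ht, hoa, hoy, h⟩ := key z hz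
        ext <;> dsimp only <;> omega
      · rintro ⟨⟨a, c⟩, t⟩ hw
        simp only [Finset.mem_sigma, Nat.mem_divisorsAntidiagonal, Finset.mem_Icc] at hw
        have h1 : (2 * (t : ℤ)).toNat + ((c : ℤ) - 2 * t).toNat = c := by omega
        have h2 : (2 * (t : ℤ) / 2).toNat = t := by omega
        simp only [Int.toNat_natCast, h1, h2]
      · intro z hz
        obtain ⟨a, t, y, rfl, ha, ht, hoa, hoy, h⟩ := key z hz
        have h2 : (2 * (t : ℤ) / 2).toNat = t := by omega
        simp only [quadWeight, Int.even_coe_nat, Nat.not_even_iff_odd.2 hoa,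
          Nat.not_even_iff_odd.2 hoy, even_two_mul, or_self, if_true, if_false,
          Int.toNat_natCast, h2]
        ring
    · rintro ⟨a, b, x, y⟩ hz
      simp only [Finset.mem_filter, mem_productQuadruples] at hz
      obtain ⟨⟨⟨ha, hb, hx, hy, h⟩, hr⟩, hx2⟩ := hz
      obtain rfl : b = a := by omega
      have ho : Odd (b * (x + y)) := by
        rw [mul_add, h]
        push_cast
        exact odd_two_mul_add_one _
      obtain ⟨ho1, ho2⟩ := Int.odd_mul.1 ho
      have hy2 : Even y := by grind
      simp [quadWeight, hy2]
  have h2 : ∀ k : ℕ, ∀ a : ℤ, 4 * ∑ t ∈ Finset.Icc 1 k, 2 * a * t = a * (2 * k + 1) ^ 2 - a := by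
    intro k a
    induction k with
    | zero => simp
    | succ k ih =>
      rw [Finset.sum_Icc_succ_top (by omega), mul_add, ih]
      push_cast
      ring
  have h3 : ∀ w ∈ (2 * m + 1).divisorsAntidiagonal, 4 * ∑ t ∈ Finset.Icc 1 (w.2 / 2),
      2 * (w.1 : ℤ) * t = (2 * m + 1) * w.2 - w.1 := by
    rintro ⟨a, c⟩ hw
    have h := (Nat.mem_divisorsAntidiagonal.1 hw).1
    have ho : Odd (a * c) := h ▸ odd_two_mul_add_one m
    obtain ⟨k, rfl⟩ := (Nat.odd_mul.1 ho).2
    have h' : (a : ℤ) * (2 * k + 1) = 2 * m + 1 := by exact_mod_cast h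
    dsimp only
    rw [h2, show (2 * k + 1) / 2 = k by omega, ← h']
    push_cast
    ring
  rw [h1, Finset.mul_sum, Finset.sum_congr rfl h3, Finset.sum_sub_distrib, ← Finset.mul_sum,
    Nat.sum_divisorsAntidiagonal' fun _ d => (d : ℤ), Nat.sum_divisorsAntidiagonal fun d _ => (d : ℤ),
    ArithmeticFunction.sigma_one_apply]
  push_cast
  ring

theorem four_mul_sum_altSigma_mul_sigma (m : ℕ) :
    4 * ∑ u ∈ Finset.HasAntidiagonal.antidiagonal m,
        altSigma u.1 * (ArithmeticFunction.sigma 1 (2 * u.2 + 1) : ℤ) =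
      m * (ArithmeticFunction.sigma 1 (2 * m + 1) : ℤ) := by
  have h1 := four_mul_sum_diag_quadWeight m
  rw [← sum_quadWeight_eq_sum_diag, sum_quadWeight_eq_sum_convWeight, sum_convWeight_eq] at h1
  linarith

/-! ### Generating series and divisibility by 5 -/

/-- The generating series of the triangular numbers. -/
noncomputable def triangularSeries : PowerSeries ℤ :=
  open Classical in PowerSeries.mk fun n => if ∃ k : ℕ, n = k * (k + 1) / 2 then 1 else 0

theorem strictMono_triangular : StrictMono fun j : ℕ => j * (j + 1) / 2 := by
  refine strictMono_nat_of_lt_succ fun j => ?_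
  have h : (j + 1) * (j + 1 + 1) = j * (j + 1) + 2 * (j + 1) := by ring
  omega

theorem le_triangular (j : ℕ) : j ≤ j * (j + 1) / 2 :=
  strictMono_triangular.le_apply

/-- The filter excludes spurious terms g 0 from truncated subtraction; the range loses nothing
because j ≤ j(j+1)/2. -/
theorem coeff_triangularSeries_mul (g : ℕ → ℤ) (n : ℕ) :
    PowerSeries.coeff n (triangularSeries * PowerSeries.mk g) =
      ∑ j ∈ Finset.range (n + 1) with j * (j + 1) / 2 ≤ n, g (n - j * (j + 1) / 2) := by
  classical
  simp only [PowerSeries.coeff_mul, triangularSeries, PowerSeries.coeff_mk, ite_mul, one_mul,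
    zero_mul]
  rw [← Finset.sum_filter]
  symm
  refine Finset.sum_bij (fun j _ => (j * (j + 1) / 2, n - j * (j + 1) / 2)) ?_ ?_ ?_ ?_
  · intro j hj
    simp only [Finset.mem_filter, Finset.HasAntidiagonal.mem_antidiagonal] at hj ⊢
    exact ⟨by omega, j, rfl⟩
  · intro j _ k _ h
    exact strictMono_triangular.injective (Prod.ext_iff.1 h).1
  · rintro ⟨u, v⟩ huv
    simp only [Finset.mem_filter, Finset.HasAntidiagonal.mem_antidiagonal] at huv
    obtain ⟨huv, k, rfl⟩ := huv
    have := le_triangular k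
    refine ⟨k, ?_, ?_⟩
    · simp only [Finset.mem_filter, Finset.mem_range]
      omega
    · ext <;> dsimp only
      omega
  · intro j _
    rfl

theorem PowerSeries.coeff_X_mul_derivative {R : Type*} [CommSemiring R] (f : PowerSeries R)
    (n : ℕ) : coeff n (X * derivative R f) = n * coeff n f := by
  cases n with
  | zero => simp
  | succ n =>
    rw [coeff_succ_X_mul, coeff_derivative]
    push_cast
    ring

theorem X_mul_derivative_triangularSeries :
    PowerSeries.X * PowerSeries.derivative ℤ triangularSeries =
      PowerSeries.mk altSigma * triangularSeries := by
  ext n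
  rw [PowerSeries.coeff_X_mul_derivative, mul_comm (PowerSeries.mk _), coeff_triangularSeries_mul,
    Finset.sum_filter_of_ne, triangularSeries, PowerSeries.coeff_mk]
  · split_ifs with h
    · obtain ⟨r, rfl⟩ := h
      rw [sum_altSigma_triangular, mul_one]
    · rw [sum_altSigma_of_not_triangular h, mul_zero]
  · intro j _ h
    by_contra hj
    -- A term outside the filter is `altSigma 0`, an empty sum.
    rw [Nat.sub_eq_zero_of_le (by omega)] at h
    exact h (by simp [altSigma])

/-- The generating series of the divisor sums of the odd numbers. -/
noncomputable def oddSigmaSeries : PowerSeries ℤ :=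
  PowerSeries.mk fun m => (ArithmeticFunction.sigma 1 (2 * m + 1) : ℤ)

theorem X_mul_derivative_oddSigmaSeries :
    PowerSeries.X * PowerSeries.derivative ℤ oddSigmaSeries =
      4 * (PowerSeries.mk altSigma * oddSigmaSeries) := by
  ext m
  rw [PowerSeries.coeff_X_mul_derivative, ← map_ofNat (PowerSeries.C (R := ℤ)) 4,
    PowerSeries.coeff_C_mul, PowerSeries.coeff_mul]
  simp only [oddSigmaSeries, PowerSeries.coeff_mk]
  exact (four_mul_sum_altSigma_mul_sigma m).symm

theorem five_dvd_coeff_triangularSeries_mul_oddSigmaSeries {n : ℕ} (hn : ¬ 5 ∣ n) :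
    (5 : ℤ) ∣ PowerSeries.coeff n (triangularSeries * oddSigmaSeries) := by
  have h : PowerSeries.X * PowerSeries.derivative ℤ (triangularSeries * oddSigmaSeries) =
      PowerSeries.C (5 : ℤ) * (PowerSeries.mk altSigma * triangularSeries * oddSigmaSeries) := by
    rw [Derivation.leibniz, smul_eq_mul, smul_eq_mul, map_ofNat]
    linear_combination triangularSeries * X_mul_derivative_oddSigmaSeries +
      oddSigmaSeries * X_mul_derivative_triangularSeries
  have h2 := congrArg (PowerSeries.coeff n) h
  rw [PowerSeries.coeff_X_mul_derivative, PowerSeries.coeff_C_mul] at h2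
  have h3 : (5 : ℤ) ∣ n * PowerSeries.coeff n (triangularSeries * oddSigmaSeries) := ⟨_, h2⟩
  refine ((Nat.prime_iff_prime_int.1 Nat.prime_five).dvd_or_dvd h3).resolve_left fun h4 => hn ?_
  exact_mod_cast h4

/-! ### Congruence modulo 4 and passage to the sums over integers -/

/-- Only even divisors d contribute to the difference, each by 2d. -/
theorem four_dvd_sigma_sub_altSigma (k : ℕ) :
    (4 : ℤ) ∣ ArithmeticFunction.sigma 1 k - altSigma k := by
  rw [ArithmeticFunction.sigma_one_apply, altSigma, Nat.cast_sum, ← Finset.sum_sub_distrib]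
  refine Finset.dvd_sum fun d _ => ?_
  split_ifs with h
  · obtain ⟨c, rfl⟩ := h
    exact ⟨c, by push_cast; ring⟩
  · simp

/-- The case split is needed because truncated subtraction would give σ(1) = 1 instead of 0; in
`sumDiv_sub_triangular` it gives σ(0) = 0. -/
theorem sumDiv_two_mul_add_one_sub (n j : ℕ) :
    sumDiv (2 * (n : ℤ) + 1 - (j : ℤ) * ((j : ℤ) + 1)) =
      if j * (j + 1) / 2 ≤ n then
        ArithmeticFunction.sigma 1 (2 * (n - j * (j + 1) / 2) + 1) else 0 := by
  obtain ⟨t, ht⟩ := (Nat.even_mul_succ_self j).two_dvd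
  have ht' : (j : ℤ) * (j + 1) = 2 * t := by exact_mod_cast ht
  rw [sumDiv, ht, ht', Nat.mul_div_cancel_left _ two_pos]
  split_ifs
  · congr 1
    omega
  · omega
  · omega
  · rfl

theorem sumDiv_sub_triangular (n j : ℕ) :
    sumDiv ((n : ℤ) - (j : ℤ) * ((j : ℤ) + 1) / 2) =
      ArithmeticFunction.sigma 1 (n - j * (j + 1) / 2) := by
  obtain ⟨t, ht⟩ := (Nat.even_mul_succ_self j).two_dvd
  have ht' : (j : ℤ) * (j + 1) = 2 * t := by exact_mod_cast ht
  rw [sumDiv, ht, ht', Nat.mul_div_cancel_left _ two_pos, Int.mul_ediv_cancel_left _ two_ne_zero]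
  split_ifs
  · congr 1
    omega
  · rw [Nat.sub_eq_zero_of_le (by omega), ArithmeticFunction.map_zero]

theorem support_sumDiv_two_mul_add_one_sub (n : ℕ) :
    (Function.support fun j : ℕ => sumDiv (2 * (n : ℤ) + 1 - (j : ℤ) * ((j : ℤ) + 1))) ⊆
      Finset.range (n + 1) := by
  intro j hj
  rw [Function.mem_support, sumDiv_two_mul_add_one_sub] at hj
  have := le_triangular j
  rw [Finset.coe_range, Set.mem_Iio]
  by_contra h
  exact hj (if_neg (by omega))

theorem support_sumDiv_sub_triangular (n : ℕ) :
    (Function.support fun j : ℕ => sumDiv ((n : ℤ) - (j : ℤ) * ((j : ℤ) + 1) / 2)) ⊆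
      Finset.range (n + 1) := by
  intro j hj
  rw [Function.mem_support, sumDiv_sub_triangular] at hj
  have := le_triangular j
  rw [Finset.coe_range, Set.mem_Iio]
  by_contra h
  rw [Nat.sub_eq_zero_of_le (by omega)] at hj
  exact hj ArithmeticFunction.map_zero

/-- Each sum over all `j ≥ 0` has only finitely many nonzero terms, so it is a finite sum; the
arguments are integers, and the division by `2` is exact. -/
theorem theorem1 (n : ℕ) (hn : 0 < n) :
    ((Function.support fun j : ℕ => sumDiv (2 * (n : ℤ) + 1 - (j : ℤ) * ((j : ℤ) + 1))).Finite ∧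
      (¬ 5 ∣ n →
        (∑ᶠ j : ℕ, sumDiv (2 * (n : ℤ) + 1 - (j : ℤ) * ((j : ℤ) + 1))) ≡ 0 [MOD 5])) ∧
    ((Function.support fun j : ℕ => sumDiv ((n : ℤ) - (j : ℤ) * ((j : ℤ) + 1) / 2)).Finite ∧
      ((¬ ∃ k : ℕ, n = k * (k + 1) / 2) →
        (∑ᶠ j : ℕ, sumDiv ((n : ℤ) - (j : ℤ) * ((j : ℤ) + 1) / 2)) ≡ 0 [MOD 4])) := by
  refine ⟨⟨(Finset.finite_toSet _).subset (support_sumDiv_two_mul_add_one_sub n), fun h5 => ?_⟩,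
    (Finset.finite_toSet _).subset (support_sumDiv_sub_triangular n), fun htri => ?_⟩
  · rw [finsum_eq_sum_of_support_subset _ (support_sumDiv_two_mul_add_one_sub n),
      Nat.modEq_zero_iff_dvd]
    simp only [sumDiv_two_mul_add_one_sub]
    have h := five_dvd_coeff_triangularSeries_mul_oddSigmaSeries h5
    rw [oddSigmaSeries, coeff_triangularSeries_mul] at h
    rw [← Finset.sum_filter]
    exact_mod_cast h
  · rw [finsum_eq_sum_of_support_subset _ (support_sumDiv_sub_triangular n),
      Nat.modEq_zero_iff_dvd]
    simp only [sumDiv_sub_triangular]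
    have h : (4 : ℤ) ∣ ∑ j ∈ Finset.range (n + 1),
        ((ArithmeticFunction.sigma 1 (n - j * (j + 1) / 2) : ℤ) -
          altSigma (n - j * (j + 1) / 2)) :=
      Finset.dvd_sum fun j _ => four_dvd_sigma_sub_altSigma _
    rw [Finset.sum_sub_distrib, sum_altSigma_of_not_triangular htri, sub_zero] at h
    exact_mod_cast h
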